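/- **Theorem.** Consider $N$ queues with state $\bar X(t)=(X_1(t),\dots,X_N(t))\in\mathbb Z_+^N$, $t\ge 0$, evolving by $$X_i(t)=X_i(0)+A_i(t)-\Pi_i\Big(\int_0^t\psi_i(\bar X(\tau))\,d\tau\Big),\qquad i=1,\dots,N,$$ where $A_i$ is a Poisson process of rate $\lambda_i\ge 0$, $\Pi_i$ is a unit-rate Poisson process, and $\bar X(0)$ and all the processes $A_1,\dots,A_N,\Pi_1,\dots,\Pi_N$ are independent. Assume the following. - $h:[0,\infty)\to\mathbb R\cup\{-\infty\}$ is strictly increasing, is finite, differentiable and concave on $(0,\infty)$, and satisfies $h(0)=\lim_{y\downarrow 0}h(y)\in[-\infty,\infty)$. - $g:\mathbb Z_+\to[0,\infty)$ is strictly increasing, and $g(y)/\Delta(y)\to\infty$ as $y\to\infty$, where $\Delta(y)=g(y+1)-g(y)$. - $\mathcal C\subset[0,\infty)^N$ is compact and coordinate-convex: if $\bar\mu\in\mathcal C$ and $0\le\bar\mu^*\le\bar\mu$ coordinate-wise, then $\bar\mu^*\in\mathcal C$. - For every $\bar x\in\mathbb Z_+^N$ and every $i$: $\psi_i(\bar x)\in[0,1]$;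 $\psi_i(\bar x)=0$ if $x_i=0$; and $\bar\psi(\bar x)\in\arg\max_{\bar\mu\in\mathcal C}\sum_i g(x_i)h(\mu_i)$, with the convention $0\cdot(-\infty)=0$. - $\bar\nu\in\mathcal C$ and $\varepsilon>0$ satisfy $\lambda_i<\nu_i-\varepsilon$ for all $i$. Let $\bar X=(X_1,\dots,X_N)$ have a stationary distribution of the process, that is, $\bar X$ is distributed as $\bar X(0)$ for a process as above for which the law of $\bar X(t)$ does not depend on $t$. Then the expectations $\mathbb E\,g(X_i)$ and $\mathbb E\,\Delta(X_i)$ are finite for every $i$, and $$\sum_i h'(\nu_i)\,\mathbb E\,g(X_i)\le\frac1\varepsilon\sum_i h'(\nu_i)\,\mathbb E\,\Delta(X_i).$$ -/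

import Mathlib

open MeasureTheory ProbabilityTheory Filter Topology
open scoped NNReal ENNReal

namespace QueueNetwork

/-- Condition (H) on the utility function `h`, of which only the values on `[0, ∞)` matter:
`h` is real-valued, differentiable and concave on `(0, ∞)`, strictly increasing on `[0, ∞)`, and its
value at `0` is its limit there, which may be finite or `-∞`. -/
structure ConditionH (h : ℝ → EReal) : Prop where
  finite_of_pos : ∀ y : ℝ, 0 < y → h y ≠ ⊥ ∧ h y ≠ ⊤
  strictMonoOn : StrictMonoOn h (Set.Ici 0)
  differentiableOn : DifferentiableOn ℝ (fun y => (h y).toReal) (Set.Ioi 0)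
  concaveOn : ConcaveOn ℝ (Set.Ioi 0) (fun y => (h y).toReal)
  tendsto_zero : Tendsto h (𝓝[>] (0 : ℝ)) (𝓝 (h 0))

/-- The derivative `h'(y)` at a point `y > 0`. -/
noncomputable def utilityDeriv (h : ℝ → EReal) (y : ℝ) : ℝ :=
  deriv (fun z => (h z).toReal) y

/-- The increment `Δ(y) = g(y + 1) - g(y)`. -/
def increment (g : ℕ → ℝ) (y : ℕ) : ℝ := g (y + 1) - g y

/-- Condition (G): `g : ℤ₊ → [0, ∞)` is strictly increasing and `g(y) / Δ(y) → ∞`. -/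
structure ConditionG (g : ℕ → ℝ) : Prop where
  nonneg : ∀ y, 0 ≤ g y
  strictMono : StrictMono g
  tendsto_ratio : Tendsto (fun y => g y / increment g y) atTop atTop

/-- A compact, coordinate-convex set of nonnegative rate vectors. -/
structure IsRateSet {N : ℕ} (C : Set (Fin N → ℝ)) : Prop where
  nonneg : ∀ μ ∈ C, 0 ≤ μ
  isCompact : IsCompact C
  coordinateConvex : ∀ μ ∈ C, ∀ μ' : Fin N → ℝ, 0 ≤ μ' → μ' ≤ μ → μ' ∈ C

/-- The utility `∑ i, g(x i) h(μ i) ∈ [-∞, ∞)` of the rate vector `μ` in state `x`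
(with the convention `0 * (-∞) = 0`, which is the one of `EReal`). -/
noncomputable def utility {N : ℕ} (g : ℕ → ℝ) (h : ℝ → EReal) (x : Fin N → ℕ)
    (μ : Fin N → ℝ) : EReal :=
  ∑ i, (g (x i) : EReal) * h (μ i)

/-- Conditions on the service rate allocation `ψ`: rates lie in `[0, 1]`, empty queues get no
service, and `ψ(x)` maximises the utility over `C` in every state `x`. -/
structure IsUtilityMaximising {N : ℕ} (g : ℕ → ℝ) (h : ℝ → EReal) (C : Set (Fin N → ℝ))
    (ψ : (Fin N → ℕ) → Fin N → ℝ) : Prop where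
  mem_Icc : ∀ x i, ψ x i ∈ Set.Icc (0 : ℝ) 1
  eq_zero : ∀ x i, x i = 0 → ψ x i = 0
  mem : ∀ x, ψ x ∈ C
  isMax : ∀ x, IsMaxOn (utility g h x) C (ψ x)

/-- `A` is a Poisson process of rate `r` (`A ≡ 0` almost surely if `r = 0`). -/
structure IsPoissonProcess {Ω : Type*} [MeasurableSpace Ω] (P : Measure Ω) (r : ℝ≥0)
    (A : ℝ≥0 → Ω → ℕ) : Prop where
  measurable : ∀ t, Measurable (A t)
  zero : ∀ᵐ ω ∂P, A 0 ω = 0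
  monotone : ∀ᵐ ω ∂P, Monotone fun t => A t ω
  rightContinuous : ∀ᵐ ω ∂P, ∀ t, ContinuousWithinAt (fun s => A s ω) (Set.Ici t) t
  indepIncrements : HasIndepIncrements A P
  law_increment : ∀ s t : ℝ≥0, s ≤ t →
    P.map (fun ω => A t ω - A s ω) = poissonMeasure (r * (t - s))

/-- `X` is the queue length process with arrival rates `lam` and service rate allocation `ψ`, driven
by Poisson arrival processes `A i` of rates `lam i` and unit-rate Poisson processes `S i`: the
initial state and all the driving processes are independent, and
`X i t = X i 0 + A i t - S i (∫₀ᵗ ψ i (X τ) dτ)`. -/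
structure IsQueueProcess {N : ℕ} {Ω : Type*} [MeasurableSpace Ω] (P : Measure Ω)
    (lam : Fin N → ℝ≥0) (ψ : (Fin N → ℕ) → Fin N → ℝ)
    (A S : Fin N → ℝ≥0 → Ω → ℕ) (X : ℝ≥0 → Ω → Fin N → ℕ) : Prop where
  arrival : ∀ i, IsPoissonProcess P (lam i) (A i)
  service : ∀ i, IsPoissonProcess P 1 (S i)
  indep_driving : iIndepFun (fun (k : Fin N ⊕ Fin N) (ω : Ω) (t : ℝ≥0) => Sum.elim A S k t ω) P
  indep_initial : IndepFun (X 0)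
    (fun (ω : Ω) (k : Fin N ⊕ Fin N) (t : ℝ≥0) => Sum.elim A S k t ω) P
  measurable : ∀ t, Measurable (X t)
  rightContinuous : ∀ᵐ ω ∂P, ∀ t, ContinuousWithinAt (fun s => X s ω) (Set.Ici t) t
  evolution : ∀ᵐ ω ∂P, ∀ (t : ℝ≥0) (i : Fin N),
    (X t ω i : ℤ) = (X 0 ω i : ℤ) + (A i t ω : ℤ)
      - (S i (∫ τ in (0 : ℝ)..(t : ℝ), ψ (X τ.toNNReal ω) i).toNNReal ω : ℤ)

/-- `X` is in the stationary regime: the law of `X t` (a stationary distribution) does not depend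
on `t`. -/
def IsStationary {N : ℕ} {Ω : Type*} [MeasurableSpace Ω] (P : Measure Ω)
    (X : ℝ≥0 → Ω → Fin N → ℕ) : Prop :=
  ∀ t, P.map (X t) = P.map (X 0)

end QueueNetwork

/-!
The proof is a Foster–Lyapunov argument with the function
`V x = ∑ i, h'(ν i) * (g 1 + ⋯ + g (x i))` (`QueueNetwork.lyapunov`).

*Drift.* The generator applied to `V` is `∑ i, h'(ν i) * (lam i * g (x i + 1) - ψ i * g (x i))`.
Comparing the maximiser `ψ x` with `ν` and replacing the concave `h` by its tangents at the `ν i`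
gives `∑ i, h'(ν i) * g (x i) * (ψ i - ν i) ≥ 0` (`IsUtilityMaximising.weighted_sub_nonneg`); the
tangent inequality persists at `0`, where `h` may be `-∞`. The same inequality in the states with at
most one customer forces `g 0 = 0` and `ν i ≤ 1`, hence `lam i ≤ 1`. So the drift is at most
`∑ i, h'(ν i) * Δ (x i) - ε * ∑ i, h'(ν i) * g (x i)` (`generator_lyapunov_le`).

*Stationarity.* For bounded `f` the generator of `f` has mean zero
(`IsQueueProcess.integral_generator_eq_zero`). This is read off the time-change equation as the
time `t` tends to `0`, without using the Markov property. As long as at most one of the driving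
processes has jumped by time `t`, and only once, the services completed are those of the rates frozen
at `ψ (X 0)` (`service_offered_eq`); the initial state is independent of the driving processes, so the
mean contribution of these jumps is exactly `t` times the mean of the generator. The remaining paths
contribute `O(t ^ 2)`, by the second factorial moment of the Poisson total number of jumps.

*Conclusion.* `V` itself need not be integrable, so the stationary identity is applied to `min V m`,
whose drift is at most that of `V` on `{V < m}` and nonpositive elsewhere (`generator_min_le`). Since
`g / Δ` tends to infinity, `Δ ≤ (ε / 2) * g + K`, which bounds the mean of `∑ i, h'(ν i) * g (X i)`
over all sublevel sets; letting `m` tend to infinity gives integrability and the inequality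
(`IsQueueProcess.foster`).
-/

namespace QueueNetwork

/-! ### Consequences of utility maximisation -/

lemma coe_finset_sum {ι : Type*} (s : Finset ι) (f : ι → ℝ) :
    ((∑ i ∈ s, f i : ℝ) : EReal) = ∑ i ∈ s, (f i : EReal) :=
  map_sum (⟨⟨fun y : ℝ => (y : EReal), EReal.coe_zero⟩, EReal.coe_add⟩ : ℝ →+ EReal) f s

section Utility

variable {h : ℝ → EReal}

lemma ConditionH.coe_toReal (hh : ConditionH h) {y : ℝ} (hy : 0 < y) :
    ((h y).toReal : EReal) = h y :=
  EReal.coe_toReal (hh.finite_of_pos y hy).2 (hh.finite_of_pos y hy).1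

lemma ConditionH.hasDerivAt (hh : ConditionH h) {y : ℝ} (hy : 0 < y) :
    HasDerivAt (fun z => (h z).toReal) (utilityDeriv h y) y :=
  ((hh.differentiableOn y hy).differentiableAt (Ioi_mem_nhds hy)).hasDerivAt

lemma ConditionH.toReal_le_tangent (hh : ConditionH h) {ν μ : ℝ} (hν : 0 < ν) (hμ : 0 < μ) :
    (h μ).toReal ≤ (h ν).toReal + utilityDeriv h ν * (μ - ν) := by
  rcases lt_trichotomy ν μ with hlt | rfl | hlt
  · have := hh.concaveOn.slope_le_of_hasDerivAt hν hμ hlt (hh.hasDerivAt hν)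
    rw [slope_def_field, div_le_iff₀ (sub_pos.2 hlt)] at this
    linarith
  · simp
  · have := hh.concaveOn.le_slope_of_hasDerivAt hμ hν hlt (hh.hasDerivAt hν)
    rw [slope_def_field, le_div_iff₀ (sub_pos.2 hlt)] at this
    linarith

lemma ConditionH.utilityDeriv_pos (hh : ConditionH h) {ν : ℝ} (hν : 0 < ν) :
    0 < utilityDeriv h ν := by
  have hν' : 0 < ν + 1 := by linarith
  have h1 := hh.toReal_le_tangent hν hν'
  have h2 : h ν < h (ν + 1) := hh.strictMonoOn hν.le hν'.le (by linarith)
  rw [← hh.coe_toReal hν, ← hh.coe_toReal hν', EReal.coe_lt_coe_iff] at h2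
  linarith

/-- The tangent inequality for `h` in `EReal`. It holds up to `μ = 0`, where `h` may be `-∞`. -/
lemma ConditionH.le_tangent (hh : ConditionH h) {ν μ : ℝ} (hν : 0 < ν) (hμ : 0 ≤ μ) :
    h μ ≤ (((h ν).toReal + utilityDeriv h ν * (μ - ν) : ℝ) : EReal) := by
  have key : ∀ y, 0 < y →
      h y ≤ (((h ν).toReal + utilityDeriv h ν * (y - ν) : ℝ) : EReal) := by
    intro y hy
    rw [← hh.coe_toReal hy, EReal.coe_le_coe_iff]
    exact hh.toReal_le_tangent hν hy
  rcases hμ.eq_or_lt with rfl | hμ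
  · have hc : Continuous fun y : ℝ =>
        (((h ν).toReal + utilityDeriv h ν * (y - ν) : ℝ) : EReal) :=
      continuous_coe_real_ereal.comp (by fun_prop)
    exact le_of_tendsto_of_tendsto hh.tendsto_zero (hc.continuousAt.tendsto.mono_left inf_le_left)
      (eventually_nhdsWithin_of_forall key)
  · exact key μ hμ

/-- In every state, the maximising allocation dominates `ν` for the linear functional whose weights
are `h'(ν i) g(x i)`: this is the first-order form of utility maximisation. -/
lemma IsUtilityMaximising.weighted_sub_nonneg {N : ℕ} {g : ℕ → ℝ} {C : Set (Fin N → ℝ)}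
    {ψ : (Fin N → ℕ) → Fin N → ℝ} (hψ : IsUtilityMaximising g h C ψ) (hg : ConditionG g)
    (hh : ConditionH h) {ν : Fin N → ℝ} (hν : ν ∈ C) (hpos : ∀ i, 0 < ν i) (x : Fin N → ℕ) :
    0 ≤ ∑ i, utilityDeriv h (ν i) * g (x i) * (ψ x i - ν i) := by
  have h1 : utility g h x ν ≤ utility g h x (ψ x) := hψ.isMax x hν
  have h2 : utility g h x ν = ((∑ i, g (x i) * (h (ν i)).toReal : ℝ) : EReal) := by
    simp only [utility, coe_finset_sum, EReal.coe_mul, hh.coe_toReal (hpos _)]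
  have h3 : utility g h x (ψ x) ≤ ((∑ i, g (x i) *
      ((h (ν i)).toReal + utilityDeriv h (ν i) * (ψ x i - ν i)) : ℝ) : EReal) := by
    simp only [utility, coe_finset_sum]
    refine Finset.sum_le_sum fun i _ => ?_
    rw [EReal.coe_mul]
    exact mul_le_mul_of_nonneg_left (hh.le_tangent (hpos i) (hψ.mem_Icc x i).1)
      (EReal.coe_nonneg.2 (hg.nonneg _))
  have h4 := h1.trans h3
  rw [h2, EReal.coe_le_coe_iff, ← sub_nonneg, ← Finset.sum_sub_distrib] at h4
  refine h4.trans_eq (Finset.sum_congr rfl fun i _ => by ring)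

variable {N : ℕ} {g : ℕ → ℝ} {C : Set (Fin N → ℝ)} {ψ : (Fin N → ℕ) → Fin N → ℝ}

/-- If the empty state had positive weights, idling there would not be optimal. -/
lemma IsUtilityMaximising.weight_zero (hψ : IsUtilityMaximising g h C ψ) (hg : ConditionG g)
    (hh : ConditionH h) {ν : Fin N → ℝ} (hν : ν ∈ C) (hpos : ∀ i, 0 < ν i) (i : Fin N) :
    g 0 = 0 := by
  refine le_antisymm ?_ (hg.nonneg 0)
  by_contra! h0
  have h1 := hψ.weighted_sub_nonneg hg hh hν hpos 0
  have h2 : ∑ j, utilityDeriv h (ν j) * g ((0 : Fin N → ℕ) j) * (ψ 0 j - ν j) < 0 := by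
    refine Finset.sum_neg (fun j _ => ?_) ⟨i, Finset.mem_univ i⟩
    rw [hψ.eq_zero 0 j rfl, zero_sub, mul_neg, neg_lt_zero]
    exact mul_pos (mul_pos (hh.utilityDeriv_pos (hpos j)) h0) (hpos j)
  linarith

/-- The state in which only queue `i` is nonempty shows that `ν i` is at most the service rate of
that queue there, hence at most `1`. -/
lemma IsUtilityMaximising.rate_le_one (hψ : IsUtilityMaximising g h C ψ) (hg : ConditionG g)
    (hh : ConditionH h) {ν : Fin N → ℝ} (hν : ν ∈ C) (hpos : ∀ i, 0 < ν i) (i : Fin N) :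
    ν i ≤ 1 := by
  have h1 := hψ.weighted_sub_nonneg hg hh hν hpos (Pi.single i 1)
  have h0 := hψ.weight_zero hg hh hν hpos i
  rw [Finset.sum_eq_single i (fun j _ hj => by simp [hj, h0]) (by simp),
    Pi.single_eq_same] at h1
  have h2 : 0 < utilityDeriv h (ν i) * g 1 :=
    mul_pos (hh.utilityDeriv_pos (hpos i)) (h0 ▸ hg.strictMono one_pos)
  have h3 := nonneg_of_mul_nonneg_right h1 h2
  have h4 := (hψ.mem_Icc (Pi.single i 1) i).2
  linarith

end Utility

lemma ConditionG.increment_pos {g : ℕ → ℝ} (hg : ConditionG g) (y : ℕ) : 0 < increment g y :=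
  sub_pos.2 (hg.strictMono y.lt_succ_self)

lemma ConditionG.exists_increment_le {g : ℕ → ℝ} (hg : ConditionG g) {δ : ℝ} (hδ : 0 < δ) :
    ∃ K : ℝ, ∀ y, increment g y ≤ δ * g y + K := by
  obtain ⟨n, hn⟩ := eventually_atTop.1 (hg.tendsto_ratio.eventually_ge_atTop δ⁻¹)
  have hK : 0 ≤ ∑ k ∈ Finset.range n, increment g k :=
    Finset.sum_nonneg fun k _ => (hg.increment_pos k).le
  refine ⟨∑ k ∈ Finset.range n, increment g k, fun y => ?_⟩
  rcases lt_or_ge y n with hy | hy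
  · have h1 := Finset.single_le_sum (f := increment g) (fun k _ => (hg.increment_pos k).le)
      (Finset.mem_range.2 hy)
    have h2 := mul_nonneg hδ.le (hg.nonneg y)
    linarith
  · have h1 := (le_div_iff₀ (hg.increment_pos y)).1 (hn y hy)
    rw [inv_mul_le_iff₀ hδ] at h1
    linarith

/-! ### Paths with at most one driving event -/

/-- A right-continuous function is the pointwise limit of its values at the grid points
`(⌊(n + 1) t⌋ + 1) / (n + 1)`, which lie to the right of `t`. -/
lemma measurable_of_continuousWithinAt_Ici {q : ℝ → ℝ}
    (hq : ∀ t, ContinuousWithinAt q (Set.Ici t) t) : Measurable q := by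
  refine measurable_of_tendsto_metrizable
    (f := fun (n : ℕ) (t : ℝ) => q ((⌊((n : ℝ) + 1) * t⌋ + 1 : ℝ) / ((n : ℝ) + 1))) ?_ ?_
  · intro n
    exact (measurable_from_top (f := fun z : ℤ => q ((z + 1 : ℝ) / ((n : ℝ) + 1)))).comp
      (Int.measurable_floor.comp (measurable_const_mul _))
  · rw [tendsto_pi_nhds]
    intro t
    refine (hq t).tendsto.comp (tendsto_nhdsWithin_iff.2 ⟨?_, Eventually.of_forall fun n => ?_⟩)
    · have h1 : Tendsto (fun n : ℕ => t + 1 / ((n : ℝ) + 1)) atTop (𝓝 t) := by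
        simpa using tendsto_one_div_add_atTop_nhds_zero_nat.const_add t
      refine tendsto_of_tendsto_of_tendsto_of_le_of_le tendsto_const_nhds h1 (fun n => ?_)
        (fun n => ?_)
      · have hn : (0 : ℝ) < n + 1 := by positivity
        change t ≤ _ / _
        rw [le_div_iff₀ hn]
        linarith [(Int.lt_floor_add_one (((n : ℝ) + 1) * t)).le]
      · have hn : (0 : ℝ) < n + 1 := by positivity
        change _ / _ ≤ t + 1 / _
        rw [div_le_iff₀ hn, add_mul t, one_div, inv_mul_cancel₀ hn.ne']
        linarith [Int.floor_le (((n : ℝ) + 1) * t)]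
    · have hn : (0 : ℝ) < n + 1 := by positivity
      change t ≤ _ / _
      rw [le_div_iff₀ hn]
      linarith [(Int.lt_floor_add_one (((n : ℝ) + 1) * t)).le]

section Path

variable {N : ℕ} {ψ : (Fin N → ℕ) → Fin N → ℝ} {Y : ℝ≥0 → Fin N → ℕ}

lemma measurable_rate_comp_path (hY : ∀ t, ContinuousWithinAt Y (Set.Ici t) t) (i : Fin N) :
    Measurable fun τ : ℝ => ψ (Y τ.toNNReal) i := by
  refine measurable_of_continuousWithinAt_Ici fun t => ?_
  have h1 : ContinuousWithinAt (fun τ : ℝ => Y τ.toNNReal) (Set.Ici t) t :=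
    ContinuousWithinAt.comp (f := Real.toNNReal) (t := Set.Ici t.toNNReal) (hY t.toNNReal)
      continuous_real_toNNReal.continuousWithinAt fun τ hτ => Real.toNNReal_le_toNNReal hτ
  exact (continuous_of_discreteTopology (f := fun x => ψ x i)).continuousAt.comp_continuousWithinAt
    h1

/-- The cumulative service `∫₀ᵗ ψ i (Y τ) dτ` offered to queue `i` along the path `Y`. -/
noncomputable def offered (ψ : (Fin N → ℕ) → Fin N → ℝ) (Y : ℝ≥0 → Fin N → ℕ) (i : Fin N)
    (t : ℝ≥0) : ℝ≥0 :=
  (∫ τ in (0 : ℝ)..(t : ℝ), ψ (Y τ.toNNReal) i).toNNReal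

lemma intervalIntegrable_rate (hψ : ∀ x i, ψ x i ∈ Set.Icc (0 : ℝ) 1)
    (hY : ∀ t, ContinuousWithinAt Y (Set.Ici t) t) (i : Fin N) (a b : ℝ) :
    IntervalIntegrable (fun τ : ℝ => ψ (Y τ.toNNReal) i) volume a b := by
  refine (intervalIntegrable_const (c := (1 : ℝ))).mono_fun
    (measurable_rate_comp_path hY i).aestronglyMeasurable (Eventually.of_forall fun τ => ?_)
  simpa [abs_of_nonneg (hψ _ i).1] using (hψ (Y τ.toNNReal) i).2

lemma continuous_offered (hψ : ∀ x i, ψ x i ∈ Set.Icc (0 : ℝ) 1)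
    (hY : ∀ t, ContinuousWithinAt Y (Set.Ici t) t) (i : Fin N) : Continuous (offered ψ Y i) :=
  continuous_real_toNNReal.comp ((intervalIntegral.continuous_primitive
    (intervalIntegrable_rate hψ hY i) 0).comp NNReal.continuous_coe)

lemma monotone_offered (hψ : ∀ x i, ψ x i ∈ Set.Icc (0 : ℝ) 1)
    (hY : ∀ t, ContinuousWithinAt Y (Set.Ici t) t) (i : Fin N) : Monotone (offered ψ Y i) := by
  intro s t hst
  refine Real.toNNReal_le_toNNReal ?_
  exact intervalIntegral.integral_mono_interval le_rfl s.2 (NNReal.coe_le_coe.2 hst)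
    (Eventually.of_forall fun τ => (hψ _ i).1) (intervalIntegrable_rate hψ hY i _ _)

lemma offered_le (hψ : ∀ x i, ψ x i ∈ Set.Icc (0 : ℝ) 1)
    (hY : ∀ t, ContinuousWithinAt Y (Set.Ici t) t) (i : Fin N) (t : ℝ≥0) : offered ψ Y i t ≤ t := by
  refine Real.toNNReal_le_iff_le_coe.2 ?_
  have := intervalIntegral.integral_mono_on t.2 (intervalIntegrable_rate hψ hY i 0 t)
    (intervalIntegrable_const (c := (1 : ℝ))) fun τ _ => (hψ (Y τ.toNNReal) i).2
  simpa using this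

lemma offered_eq_of_constant {t : ℝ≥0} (hconst : ∀ v < t, Y v = Y 0) (i : Fin N) :
    offered ψ Y i t = t * (ψ (Y 0) i).toNNReal := by
  have h1 : ∫ τ in (0 : ℝ)..(t : ℝ), ψ (Y τ.toNNReal) i = ∫ τ in (0 : ℝ)..(t : ℝ), ψ (Y 0) i := by
    refine intervalIntegral.integral_congr_ae ?_
    filter_upwards [compl_mem_ae_iff.2 (measure_singleton (t : ℝ))] with τ hτ hmem
    rw [Set.uIoc_of_le t.coe_nonneg] at hmem
    rw [hconst]
    exact (Real.toNNReal_lt_iff_lt_coe hmem.1.le).2 (lt_of_le_of_ne hmem.2 hτ)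
  rw [offered, h1, intervalIntegral.integral_const, sub_zero, smul_eq_mul,
    Real.toNNReal_mul t.coe_nonneg, Real.toNNReal_coe]

/-- As long as at most one driving event has occurred by time `t`, the services completed by then
are those of the frozen rates `ψ (Y 0)`: the rates can only change at the single event, and from
then on no service process moves any more. -/
lemma service_offered_eq (hψ : ∀ x i, ψ x i ∈ Set.Icc (0 : ℝ) 1)
    (hY : ∀ t, ContinuousWithinAt Y (Set.Ici t) t)
    {a s : Fin N → ℝ≥0 → ℕ} (ha : ∀ i, Monotone (a i))
    (hs : ∀ i, Monotone (s i)) (hsr : ∀ i t, ContinuousWithinAt (s i) (Set.Ici t) t)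
    (hev : ∀ t i, (Y t i : ℤ) = (Y 0 i : ℤ) + (a i t : ℤ) - (s i (offered ψ Y i t) : ℤ))
    {t : ℝ≥0} (hT : ∑ i, a i t + ∑ i, s i t ≤ 1) (i : Fin N) :
    s i (offered ψ Y i t) = s i (t * (ψ (Y 0) i).toNNReal) := by
  have hclock : t * (ψ (Y 0) i).toNNReal ≤ t :=
    mul_le_of_le_one_right' (Real.toNNReal_le_one.2 (hψ _ i).2)
  have hle1 := hs i (offered_le hψ hY i t)
  have hle2 := hs i hclock
  have hsi : s i t ≤ ∑ j, s j t := Finset.single_le_sum (f := fun j => s j t)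
    (fun _ _ => Nat.zero_le _)
    (Finset.mem_univ i)
  rcases Nat.eq_zero_or_pos (s i t) with h0 | h0
  · omega
  -- otherwise the only driving event is the one counted by `s i`
  have ha0 : ∀ j, a j t = 0 := fun j => by
    have : a j t ≤ ∑ j, a j t := Finset.single_le_sum (f := fun j => a j t) (fun _ _ => Nat.zero_le _)
      (Finset.mem_univ j)
    omega
  have hs0 : ∀ j, j ≠ i → s j t = 0 := fun j hj => by
    have h1 := Finset.add_sum_erase Finset.univ (fun j => s j t) (Finset.mem_univ i)
    have h2 : s j t ≤ ∑ j ∈ Finset.univ.erase i, s j t :=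
      Finset.single_le_sum (f := fun j => s j t) (fun _ _ => Nat.zero_le _)
        (Finset.mem_erase.2 ⟨hj, Finset.mem_univ j⟩)
    omega
  -- the state cannot change before the only event, a service completion at queue `i`
  have hfreeze : ∀ v ≤ t, s i (offered ψ Y i v) = 0 → Y v = Y 0 := by
    intro v hv hv0
    ext j
    have h1 := hev v j
    have h2 : a j v = 0 := Nat.le_zero.1 ((ha j hv).trans (ha0 j).le)
    have h3 : s j (offered ψ Y j v) = 0 := by
      rcases eq_or_ne j i with rfl | hj
      · exact hv0
      · exact Nat.le_zero.1 ((hs j ((offered_le hψ hY j v).trans hv)).trans (hs0 j hj).le)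
    rw [h2, h3] at h1
    simpa using h1
  rcases Nat.eq_zero_or_pos (s i (offered ψ Y i t)) with hz | hp
  · rw [offered_eq_of_constant (fun v hv => hfreeze v hv.le (Nat.le_zero.1
      ((hs i (monotone_offered hψ hY i hv.le)).trans hz.le))) i]
  -- `σ` is the time of the service event
  set E : Set ℝ≥0 := {u | 1 ≤ s i (offered ψ Y i u)} with hE
  have hne : E.Nonempty := ⟨t, hp⟩
  set σ := sInf E
  have hσt : σ ≤ t := csInf_le (OrderBot.bddBelow E) hp
  have hbefore : ∀ v < σ, s i (offered ψ Y i v) = 0 := fun v hv => by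
    have : v ∉ E := notMem_of_lt_csInf hv (OrderBot.bddBelow E)
    simpa [hE] using this
  have hoff : offered ψ Y i σ = σ * (ψ (Y 0) i).toNNReal :=
    offered_eq_of_constant (fun v hv => hfreeze v (hv.le.trans hσt) (hbefore v hv)) i
  have hright : ContinuousWithinAt (fun u => s i (offered ψ Y i u)) (Set.Ici σ) σ :=
    ContinuousWithinAt.comp (f := offered ψ Y i) (t := Set.Ici (offered ψ Y i σ)) (hsr i _)
      (continuous_offered hψ hY i).continuousWithinAt fun u hu => monotone_offered hψ hY i hu
  have hev1 : ∀ᶠ u in 𝓝[≥] σ, s i (offered ψ Y i u) = s i (offered ψ Y i σ) := by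
    have := hright.tendsto
    rw [nhds_discrete, tendsto_pure] at this
    exact this
  -- the infimum is attained: `E` has points arbitrarily close to `σ` on its right
  obtain ⟨u, huE, hu⟩ :=
    (((isGLB_csInf hne (OrderBot.bddBelow E)).frequently_mem hne).and_eventually hev1).exists
  have h1 : 1 ≤ s i (offered ψ Y i σ) := hu ▸ huE
  rw [hoff] at h1
  have h2 : s i (σ * (ψ (Y 0) i).toNNReal) ≤ s i (t * (ψ (Y 0) i).toNNReal) :=
    hs i (mul_le_mul_left hσt _)
  omega

end Path

/-! ### Moments of the Poisson distribution -/

lemma hasSum_poisson_descFactorial (r : ℝ≥0) (k : ℕ) :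
    HasSum (fun n : ℕ => Real.exp (-r) * r ^ n / n.factorial * (n.descFactorial k : ℝ))
      ((r : ℝ) ^ k) := by
  have h1 : ∑ n ∈ Finset.range k,
      Real.exp (-r) * r ^ n / n.factorial * (n.descFactorial k : ℝ) = 0 :=
    Finset.sum_eq_zero fun n hn => by
      simp [Nat.descFactorial_of_lt (Finset.mem_range.1 hn)]
  rw [← hasSum_nat_add_iff' k, h1, sub_zero]
  have h2 := (hasSum_one_poissonMeasure r).mul_left ((r : ℝ) ^ k)
  rw [mul_one] at h2
  refine h2.congr_fun fun n => ?_
  have h3 := Nat.factorial_mul_descFactorial (Nat.le_add_left k n)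
  rw [Nat.add_sub_cancel] at h3
  rw [← h3, pow_add]
  have h4 : (n.factorial : ℝ) ≠ 0 := by positivity
  have h5 : ((n + k).descFactorial k : ℝ) ≠ 0 := by
    exact_mod_cast (Nat.pos_of_ne_zero fun h0 => by
      rw [Nat.descFactorial_eq_zero_iff_lt] at h0; omega).ne'
  push_cast
  field_simp

lemma integrable_descFactorial_poisson (r : ℝ≥0) (k : ℕ) :
    Integrable (fun n : ℕ => (n.descFactorial k : ℝ)) (poissonMeasure r) := by
  rw [integrable_poissonMeasure_iff]
  simpa using (hasSum_poisson_descFactorial r k).summable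

lemma integral_descFactorial_poisson (r : ℝ≥0) (k : ℕ) :
    ∫ n, (n.descFactorial k : ℝ) ∂poissonMeasure r = (r : ℝ) ^ k := by
  rw [integral_poissonMeasure]
  simpa using (hasSum_poisson_descFactorial r k).tsum_eq

section Law

variable {Ω : Type*} [MeasurableSpace Ω] {P : Measure Ω} {r : ℝ≥0}

lemma integrable_descFactorial_of_hasLaw {Z : Ω → ℕ} (hZ : HasLaw Z (poissonMeasure r) P) (k : ℕ) :
    Integrable (fun ω => ((Z ω).descFactorial k : ℝ)) P := by
  have := integrable_descFactorial_poisson r k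
  rw [← hZ.map_eq] at this
  exact this.comp_aemeasurable hZ.aemeasurable

lemma integral_descFactorial_of_hasLaw {Z : Ω → ℕ} (hZ : HasLaw Z (poissonMeasure r) P) (k : ℕ) :
    ∫ ω, ((Z ω).descFactorial k : ℝ) ∂P = (r : ℝ) ^ k := by
  rw [← integral_descFactorial_poisson, ← hZ.map_eq,
    integral_map hZ.aemeasurable (measurable_of_countable _).aestronglyMeasurable]

lemma hasLaw_sum_poisson [IsProbabilityMeasure P] {ι : Type*} {Z : ι → Ω → ℕ} {r : ι → ℝ≥0}
    (hind : iIndepFun Z P) (hmeas : ∀ k, Measurable (Z k))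
    (hlaw : ∀ k, HasLaw (Z k) (poissonMeasure (r k)) P) (s : Finset ι) :
    HasLaw (∑ k ∈ s, Z k) (poissonMeasure (∑ k ∈ s, r k)) P := by
  classical
  induction s using Finset.induction_on with
  | empty =>
    refine ⟨by simp; fun_prop, ?_⟩
    have h0 : poissonMeasure 0 = Measure.dirac 0 := by
      refine Measure.ext_of_singleton fun n => ?_
      rw [poissonMeasure_singleton]
      rcases n with _ | n <;> simp
    simp only [Finset.sum_empty, h0]
    change P.map (fun _ => 0) = _
    rw [Measure.map_const, measure_univ, one_smul]
  | insert a s ha ih =>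
    rw [Finset.sum_insert ha, Finset.sum_insert ha]
    exact IndepFun.hasLaw_add_poissonMeasure
      (hind.indepFun_finsetSum_of_notMem hmeas ha).symm (hlaw a) ih

lemma IsPoissonProcess.hasLaw {A : ℝ≥0 → Ω → ℕ} (hA : IsPoissonProcess P r A) (t : ℝ≥0) :
    HasLaw (A t) (poissonMeasure (r * t)) P := by
  refine ⟨(hA.measurable t).aemeasurable, ?_⟩
  have h1 := hA.law_increment 0 t zero_le
  rw [tsub_zero] at h1
  rw [← h1]
  refine Measure.map_congr ?_
  filter_upwards [hA.zero] with ω hω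
  simp [hω]

end Law

/-! ### The generator -/

section Generator

variable {N : ℕ}

/-- The state after one event: an arrival at queue `i` for the index `Sum.inl i`, a service
completion at queue `i` for the index `Sum.inr i`. -/
def jump (x : Fin N → ℕ) : Fin N ⊕ Fin N → Fin N → ℕ :=
  Sum.elim (fun i => x + Pi.single i 1) (fun i => x - Pi.single i 1)

/-- The rates at which the driving Poisson processes run in their own time. -/
def driveRate (lam : Fin N → ℝ≥0) : Fin N ⊕ Fin N → ℝ≥0 := Sum.elim lam 1

/-- The amount of own time used up to time `t` by each driving process if the allocation is
frozen at `ψ x`. -/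
noncomputable def clock (ψ : (Fin N → ℕ) → Fin N → ℝ) (t : ℝ≥0) (x : Fin N → ℕ) :
    Fin N ⊕ Fin N → ℝ≥0 :=
  Sum.elim (fun _ => t) (fun i => t * (ψ x i).toNNReal)

/-- The rate of each event in state `x`. -/
def eventRate (lam : Fin N → ℝ≥0) (ψ : (Fin N → ℕ) → Fin N → ℝ) (x : Fin N → ℕ) :
    Fin N ⊕ Fin N → ℝ :=
  Sum.elim (fun i => (lam i : ℝ)) (ψ x)

/-- The generator of the queue length process. -/
def generator (lam : Fin N → ℝ≥0) (ψ : (Fin N → ℕ) → Fin N → ℝ) (f : (Fin N → ℕ) → ℝ)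
    (x : Fin N → ℕ) : ℝ :=
  ∑ k, eventRate lam ψ x k * (f (jump x k) - f x)

variable {lam : Fin N → ℝ≥0} {ψ : (Fin N → ℕ) → Fin N → ℝ}

lemma clock_le (hψ : ∀ x i, ψ x i ∈ Set.Icc (0 : ℝ) 1) (t : ℝ≥0) (x : Fin N → ℕ)
    (k : Fin N ⊕ Fin N) : clock ψ t x k ≤ t := by
  rcases k with i | i
  · exact le_rfl
  · exact mul_le_of_le_one_right' (Real.toNNReal_le_one.2 (hψ _ i).2)

lemma driveRate_mul_clock (hψ : ∀ x i, ψ x i ∈ Set.Icc (0 : ℝ) 1) (t : ℝ≥0) (x : Fin N → ℕ)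
    (k : Fin N ⊕ Fin N) :
    ((driveRate lam k * clock ψ t x k : ℝ≥0) : ℝ) = t * eventRate lam ψ x k := by
  rcases k with i | i
  · simp [driveRate, clock, eventRate, mul_comm]
  · simp [driveRate, clock, eventRate, (hψ x i).1]

/-- If at most one driving event occurs up to time `t`, the change of `f` along the path is the
jump belonging to that event. -/
lemma sub_eq_sum_jump {Y : ℝ≥0 → Fin N → ℕ} (hψ : ∀ x i, ψ x i ∈ Set.Icc (0 : ℝ) 1)
    (hY : ∀ t, ContinuousWithinAt Y (Set.Ici t) t) {d : Fin N ⊕ Fin N → ℝ≥0 → ℕ}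
    (hd : ∀ k, Monotone (d k)) (hdr : ∀ k t, ContinuousWithinAt (d k) (Set.Ici t) t)
    (hev : ∀ t i, (Y t i : ℤ) =
      (Y 0 i : ℤ) + (d (.inl i) t : ℤ) - (d (.inr i) (offered ψ Y i t) : ℤ))
    {t : ℝ≥0} (hT : ∑ k, d k t ≤ 1) (f : (Fin N → ℕ) → ℝ) :
    f (Y t) - f (Y 0) = ∑ k, (d k (clock ψ t (Y 0) k) : ℝ) * (f (jump (Y 0) k) - f (Y 0)) := by
  classical
  have hs : ∀ i, d (.inr i) (offered ψ Y i t) = d (.inr i) (clock ψ t (Y 0) (.inr i)) :=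
    service_offered_eq hψ hY (a := fun i => d (.inl i)) (s := fun i => d (.inr i))
      (fun i => hd _) (fun i => hd _) (fun i => hdr _) hev (by rwa [Fintype.sum_sum_type] at hT)
  set n : Fin N ⊕ Fin N → ℕ := fun k => d k (clock ψ t (Y 0) k) with hn
  have hY' : ∀ i, (Y t i : ℤ) = (Y 0 i : ℤ) + (n (.inl i) : ℤ) - (n (.inr i) : ℤ) := fun i => by
    rw [hev t i, hs i]; rfl
  have hn1 : ∑ k, n k ≤ 1 := (Finset.sum_le_sum fun k _ => hd k (clock_le hψ t _ k)).trans hT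
  change _ = ∑ k, (n k : ℝ) * _
  by_cases h0 : ∀ k, n k = 0
  · have : Y t = Y 0 := by
      ext i
      have := hY' i
      simpa [h0] using this
    simp [this, h0]
  · push Not at h0
    obtain ⟨k, hk⟩ := h0
    have hsplit := Finset.add_sum_erase Finset.univ n (Finset.mem_univ k)
    have hother : ∀ l, l ≠ k → n l = 0 := fun l hl => by
      have h2 : n l ≤ ∑ j ∈ Finset.univ.erase k, n j :=
        Finset.single_le_sum (fun _ _ => Nat.zero_le _)
          (Finset.mem_erase.2 ⟨hl, Finset.mem_univ l⟩)
      omega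
    have hk1 : n k = 1 := by omega
    have hjump : Y t = jump (Y 0) k := by
      ext j
      have h3 := hY' j
      rcases k with i | i
      · have h4 : n (.inr j) = 0 := hother _ (by simp)
        rcases eq_or_ne j i with rfl | hj
        · simp only [jump, Sum.elim_inl, Pi.add_apply, Pi.single_eq_same]
          omega
        · have h5 : n (.inl j) = 0 := hother _ (by simpa using hj)
          simp only [jump, Sum.elim_inl, Pi.add_apply, Pi.single_eq_of_ne hj]
          omega
      · have h4 : n (.inl j) = 0 := hother _ (by simp)
        rcases eq_or_ne j i with rfl | hj
        · simp only [jump, Sum.elim_inr, Pi.sub_apply, Pi.single_eq_same]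
          omega
        · have h5 : n (.inr j) = 0 := hother _ (by simpa using hj)
          simp only [jump, Sum.elim_inr, Pi.sub_apply, Pi.single_eq_of_ne hj]
          omega
    rw [Finset.sum_eq_single k (fun l _ hl => by simp [hother l hl]) (by simp), hk1, hjump]
    simp

end Generator

/-! ### Stationary expectation of the generator -/

section Stationary

variable {N : ℕ} {Ω : Type*} [MeasurableSpace Ω] {P : Measure Ω}
  {lam : Fin N → ℝ≥0} {ψ : (Fin N → ℕ) → Fin N → ℝ} {A S : Fin N → ℝ≥0 → Ω → ℕ}
  {X : ℝ≥0 → Ω → Fin N → ℕ}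

lemma IsQueueProcess.drive (hX : IsQueueProcess P lam ψ A S X) (k : Fin N ⊕ Fin N) :
    IsPoissonProcess P (driveRate lam k) (Sum.elim A S k) := by
  rcases k with i | i
  · exact hX.arrival i
  · exact hX.service i

/-- The total number of driving events up to time `t`. -/
def eventCount (A S : Fin N → ℝ≥0 → Ω → ℕ) (t : ℝ≥0) : Ω → ℕ :=
  ∑ k : Fin N ⊕ Fin N, Sum.elim A S k t

lemma IsQueueProcess.hasLaw_eventCount [IsProbabilityMeasure P]
    (hX : IsQueueProcess P lam ψ A S X) (t : ℝ≥0) :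
    HasLaw (eventCount A S t) (poissonMeasure ((∑ k, driveRate lam k) * t)) P := by
  rw [Finset.sum_mul]
  exact hasLaw_sum_poisson
    (hX.indep_driving.comp (fun _ d => d t) fun _ => measurable_pi_apply t)
    (fun k => (hX.drive k).measurable t) (fun k => (hX.drive k).hasLaw t) Finset.univ

lemma IsQueueProcess.ae_le_eventCount (hX : IsQueueProcess P lam ψ A S X)
    (hψ : ∀ x i, ψ x i ∈ Set.Icc (0 : ℝ) 1) (t : ℝ≥0) (k : Fin N ⊕ Fin N) :
    ∀ᵐ ω ∂P, Sum.elim A S k (clock ψ t (X 0 ω) k) ω ≤ eventCount A S t ω := by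
  filter_upwards [(hX.drive k).monotone] with ω hω
  refine (hω (clock_le hψ t _ k)).trans ?_
  rw [eventCount, Finset.sum_apply]
  exact Finset.single_le_sum (f := fun k => Sum.elim A S k t ω) (fun _ _ => Nat.zero_le _)
    (Finset.mem_univ k)

/-- The driving paths, seen as a single random element of the space of families of functions, and
read off at the state-dependent time `clock ψ t x k`. -/
lemma measurable_eval_clock (t : ℝ≥0) (k : Fin N ⊕ Fin N) (c : (Fin N → ℕ) → ℝ) :
    Measurable fun p : (Fin N → ℕ) × (Fin N ⊕ Fin N → ℝ≥0 → ℕ) =>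
      (p.2 k (clock ψ t p.1 k) : ℝ) * c p.1 :=
  measurable_from_prod_countable_right fun x =>
    (measurable_of_countable (fun n : ℕ => (n : ℝ) * c x)).comp
      ((measurable_pi_apply (clock ψ t x k)).comp (measurable_pi_apply k))

lemma IsQueueProcess.measurable_drive (hX : IsQueueProcess P lam ψ A S X) :
    Measurable fun (ω : Ω) (k : Fin N ⊕ Fin N) (t : ℝ≥0) => Sum.elim A S k t ω :=
  measurable_pi_lambda _ fun k => measurable_pi_lambda _ fun t => (hX.drive k).measurable t

lemma IsQueueProcess.integrable_frozen [IsProbabilityMeasure P]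
    (hX : IsQueueProcess P lam ψ A S X)
    (hψ : ∀ x i, ψ x i ∈ Set.Icc (0 : ℝ) 1) (t : ℝ≥0) (k : Fin N ⊕ Fin N)
    {c : (Fin N → ℕ) → ℝ} {K : ℝ} (hc : ∀ x, |c x| ≤ K) :
    Integrable (fun ω => (Sum.elim A S k (clock ψ t (X 0 ω) k) ω : ℝ) * c (X 0 ω)) P := by
  have hT := (integrable_descFactorial_of_hasLaw (hX.hasLaw_eventCount t) 1).mul_const K
  refine hT.mono' ((measurable_eval_clock (ψ := ψ) t k c).comp
    ((hX.measurable 0).prodMk hX.measurable_drive)).aestronglyMeasurable ?_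
  filter_upwards [hX.ae_le_eventCount hψ t k] with ω hω
  rw [Nat.descFactorial_one, norm_mul, Real.norm_natCast, Real.norm_eq_abs]
  gcongr
  exact hc _

/-- The mean number of events of kind `k` when the allocation is frozen at `ψ (X 0)`, weighted by a
function of the initial state. It rests on the independence of the initial state and the driving
processes. -/
lemma IsQueueProcess.integral_frozen [IsProbabilityMeasure P]
    (hX : IsQueueProcess P lam ψ A S X)
    (hψ : ∀ x i, ψ x i ∈ Set.Icc (0 : ℝ) 1) (t : ℝ≥0) (k : Fin N ⊕ Fin N)
    {c : (Fin N → ℕ) → ℝ} {K : ℝ} (hc : ∀ x, |c x| ≤ K) :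
    ∫ ω, (Sum.elim A S k (clock ψ t (X 0 ω) k) ω : ℝ) * c (X 0 ω) ∂P =
      t * ∫ ω, eventRate lam ψ (X 0 ω) k * c (X 0 ω) ∂P := by
  set D : Ω → Fin N ⊕ Fin N → ℝ≥0 → ℕ := fun ω k t => Sum.elim A S k t ω
  have hDm : Measurable D := hX.measurable_drive
  have hF := measurable_eval_clock (ψ := ψ) t k c
  have hpair : Measurable fun ω => (X 0 ω, D ω) := (hX.measurable 0).prodMk hDm
  have hmap := (indepFun_iff_map_prod_eq_prod_map_map (hX.measurable 0).aemeasurable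
    hDm.aemeasurable).1 hX.indep_initial
  have hint := (integrable_map_measure hF.aestronglyMeasurable hpair.aemeasurable).2
    (hX.integrable_frozen hψ t k hc)
  rw [hmap] at hint
  have hinner : ∀ x, ∫ d, (d k (clock ψ t x k) : ℝ) * c x ∂P.map D =
      t * (eventRate lam ψ x k * c x) := by
    intro x
    have hm : Measurable fun d : Fin N ⊕ Fin N → ℝ≥0 → ℕ => (d k (clock ψ t x k) : ℝ) * c x :=
      hF.comp measurable_prodMk_left
    rw [integral_map hDm.aemeasurable hm.aestronglyMeasurable, integral_mul_const, ← mul_assoc,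
      ← driveRate_mul_clock hψ]
    have := integral_descFactorial_of_hasLaw ((hX.drive k).hasLaw (clock ψ t x k)) 1
    simp only [Nat.descFactorial_one, pow_one] at this
    rw [← this]
  calc ∫ ω, (Sum.elim A S k (clock ψ t (X 0 ω) k) ω : ℝ) * c (X 0 ω) ∂P
      = ∫ p, (p.2 k (clock ψ t p.1 k) : ℝ) * c p.1 ∂P.map (fun ω => (X 0 ω, D ω)) :=
        (integral_map hpair.aemeasurable hF.aestronglyMeasurable).symm
    _ = ∫ x, ∫ d, (d k (clock ψ t x k) : ℝ) * c x ∂P.map D ∂P.map (X 0) := by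
        rw [hmap, integral_prod _ hint]
    _ = ∫ x, t * (eventRate lam ψ x k * c x) ∂P.map (X 0) := by simp only [hinner]
    _ = _ := by
        rw [integral_map (hX.measurable 0).aemeasurable
          (measurable_of_countable _).aestronglyMeasurable, integral_const_mul]

/-- The change of `f` over `[0, t]` is the sum of the jumps at frozen rates up to an error which
vanishes unless two driving events occur. -/
lemma IsQueueProcess.ae_abs_sub_frozen_le (hX : IsQueueProcess P lam ψ A S X)
    (hψ : ∀ x i, ψ x i ∈ Set.Icc (0 : ℝ) 1) {f : (Fin N → ℕ) → ℝ} {M : ℝ}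
    (hf : ∀ x, |f x| ≤ M) (t : ℝ≥0) :
    ∀ᵐ ω ∂P, |f (X t ω) - f (X 0 ω) - ∑ k, (Sum.elim A S k (clock ψ t (X 0 ω) k) ω : ℝ) *
      (f (jump (X 0 ω) k) - f (X 0 ω))| ≤
        4 * M * ((eventCount A S t ω).descFactorial 2 : ℝ) := by
  have hM : 0 ≤ M := (abs_nonneg _).trans (hf 0)
  have hdiff : ∀ x y, |f x - f y| ≤ 2 * M := fun x y => by
    have := abs_sub (f x) (f y)
    linarith [hf x, hf y]
  filter_upwards [hX.rightContinuous, hX.evolution, ae_all_iff.2 fun k => (hX.drive k).monotone,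
    ae_all_iff.2 fun k => (hX.drive k).rightContinuous] with ω hω hev hmono hright
  have hTsum : eventCount A S t ω = ∑ k, Sum.elim A S k t ω := by
    rw [eventCount, Finset.sum_apply]
  rcases Nat.lt_or_ge (eventCount A S t ω) 2 with h1 | h2
  · rw [sub_eq_sum_jump (Y := fun t => X t ω) (d := fun k t => Sum.elim A S k t ω) hψ hω hmono
      hright hev (by omega) f, sub_self, abs_zero]
    positivity
  · have hsum : |∑ k, (Sum.elim A S k (clock ψ t (X 0 ω) k) ω : ℝ) *
        (f (jump (X 0 ω) k) - f (X 0 ω))| ≤ (eventCount A S t ω : ℝ) * (2 * M) := by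
      rw [hTsum, Nat.cast_sum, Finset.sum_mul]
      refine (Finset.abs_sum_le_sum_abs _ _).trans (Finset.sum_le_sum fun k _ => ?_)
      rw [abs_mul, Nat.abs_cast]
      gcongr
      · exact hmono k (clock_le hψ t _ k)
      · exact hdiff _ _
    have htri := abs_sub (f (X t ω) - f (X 0 ω)) (∑ k,
      (Sum.elim A S k (clock ψ t (X 0 ω) k) ω : ℝ) * (f (jump (X 0 ω) k) - f (X 0 ω)))
    have hd := hdiff (X t ω) (X 0 ω)
    obtain ⟨m, hm⟩ := Nat.exists_eq_add_of_le h2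
    -- with `T ≥ 2` events the error is at most `2 * M * (1 + T)`
    have hdesc : (1 : ℝ) + eventCount A S t ω ≤ 2 * ((eventCount A S t ω).descFactorial 2 : ℝ) := by
      have h3 : 1 + eventCount A S t ω ≤ 2 * (eventCount A S t ω).descFactorial 2 := by
        rw [hm]
        simp only [Nat.descFactorial_succ, Nat.descFactorial_zero, mul_one, Nat.sub_zero]
        rw [show 2 + m - 1 = m + 1 by omega]
        nlinarith
      exact_mod_cast h3
    nlinarith [mul_le_mul_of_nonneg_left hdesc (mul_nonneg zero_le_two hM)]

lemma abs_eventRate_mul_le (hψ : ∀ x i, ψ x i ∈ Set.Icc (0 : ℝ) 1) {c : (Fin N → ℕ) → ℝ} {K : ℝ}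
    (hc : ∀ x, |c x| ≤ K) (x : Fin N → ℕ) (k : Fin N ⊕ Fin N) :
    |eventRate lam ψ x k * c x| ≤ driveRate lam k * K := by
  rw [abs_mul]
  refine mul_le_mul ?_ (hc x) (abs_nonneg _) (NNReal.coe_nonneg _)
  rcases k with i | i
  · simp [eventRate, driveRate]
  · simpa [eventRate, driveRate, abs_of_nonneg (hψ x i).1] using (hψ x i).2

lemma integrable_comp_of_bound [IsProbabilityMeasure P]
    {X₀ : Ω → Fin N → ℕ} (hX₀ : Measurable X₀) {c : (Fin N → ℕ) → ℝ}
    {K : ℝ} (hc : ∀ x, |c x| ≤ K) : Integrable (fun ω => c (X₀ ω)) P :=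
  Integrable.of_bound ((measurable_of_countable c).comp hX₀).aestronglyMeasurable K
    (Eventually.of_forall fun _ => hc _)

/-- In the stationary regime the generator of a bounded function has mean zero: for every `t`,
`t * E[generator f (X 0)]` differs from `E[f (X t)] - E[f (X 0)] = 0` by at most a multiple of
`t ^ 2`. -/
theorem IsQueueProcess.integral_generator_eq_zero [IsProbabilityMeasure P]
    (hX : IsQueueProcess P lam ψ A S X)
    (hstat : IsStationary P X) (hψ : ∀ x i, ψ x i ∈ Set.Icc (0 : ℝ) 1)
    {f : (Fin N → ℕ) → ℝ} {M : ℝ} (hf : ∀ x, |f x| ≤ M) :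
    Integrable (fun ω => generator lam ψ f (X 0 ω)) P ∧
      ∫ ω, generator lam ψ f (X 0 ω) ∂P = 0 := by
  have hdiff : ∀ (k : Fin N ⊕ Fin N) x, |f (jump x k) - f x| ≤ 2 * M := fun k x => by
    have := abs_sub (f (jump x k)) (f x)
    linarith [hf x, hf (jump x k)]
  have hterm : ∀ k ∈ (Finset.univ : Finset (Fin N ⊕ Fin N)), Integrable (fun ω =>
      eventRate lam ψ (X 0 ω) k * (f (jump (X 0 ω) k) - f (X 0 ω))) P := fun k _ =>
    integrable_comp_of_bound (hX.measurable 0)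
      (c := fun x => eventRate lam ψ x k * (f (jump x k) - f x))
      fun x => abs_eventRate_mul_le hψ (c := fun x => f (jump x k) - f x) (hdiff k) x k
  refine ⟨integrable_finsetSum _ hterm, ?_⟩
  set I := ∫ ω, generator lam ψ f (X 0 ω) ∂P with hI
  set r : ℝ := ((∑ k, driveRate lam k : ℝ≥0) : ℝ)
  have hbound : ∀ t : ℝ≥0, t * |I| ≤ 4 * M * (r * t) ^ 2 := by
    intro t
    have hft : ∀ s, Integrable (fun ω => f (X s ω)) P := fun s =>
      integrable_comp_of_bound (hX.measurable s) hf
    have hfz : ∀ k ∈ (Finset.univ : Finset (Fin N ⊕ Fin N)), Integrable (fun ω =>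
        (Sum.elim A S k (clock ψ t (X 0 ω) k) ω : ℝ) * (f (jump (X 0 ω) k) - f (X 0 ω))) P :=
      fun k _ => hX.integrable_frozen hψ t k (c := fun x => f (jump x k) - f x) (hdiff k)
    have hstat' : ∫ ω, f (X t ω) ∂P = ∫ ω, f (X 0 ω) ∂P := by
      rw [← integral_map (hX.measurable t).aemeasurable
        (measurable_of_countable f).aestronglyMeasurable, hstat t,
        integral_map (hX.measurable 0).aemeasurable
        (measurable_of_countable f).aestronglyMeasurable]
    have hmean : ∫ ω, (f (X t ω) - f (X 0 ω) - ∑ k,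
        (Sum.elim A S k (clock ψ t (X 0 ω) k) ω : ℝ) * (f (jump (X 0 ω) k) - f (X 0 ω))) ∂P =
          -(t * I) := by
      rw [integral_sub (f := fun ω => f (X t ω) - f (X 0 ω)) ((hft t).sub (hft 0)) (integrable_finsetSum _ hfz),
        integral_sub (hft t) (hft 0), hstat', sub_self, zero_sub, integral_finsetSum _ hfz, hI]
      simp only [generator]
      rw [integral_finsetSum _ hterm, Finset.mul_sum]
      exact congrArg _ (Finset.sum_congr rfl fun k _ =>
        hX.integral_frozen hψ t k (c := fun x => f (jump x k) - f x) (hdiff k))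
    have hlaw := hX.hasLaw_eventCount t
    have hle := norm_integral_le_of_norm_le (f := fun ω => f (X t ω) - f (X 0 ω) - ∑ k,
      (Sum.elim A S k (clock ψ t (X 0 ω) k) ω : ℝ) * (f (jump (X 0 ω) k) - f (X 0 ω)))
      ((integrable_descFactorial_of_hasLaw hlaw 2).const_mul (4 * M))
      (hX.ae_abs_sub_frozen_le hψ hf t)
    rw [hmean, integral_const_mul, integral_descFactorial_of_hasLaw hlaw, norm_neg, norm_mul,
      NNReal.coe_mul,
      Real.norm_eq_abs, Real.norm_eq_abs, abs_of_nonneg t.coe_nonneg] at hle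
    exact hle
  by_contra hne
  have hpos : 0 < |I| := abs_pos.2 hne
  have hlim : Tendsto (fun t : ℝ => 4 * M * r ^ 2 * t) (𝓝[>] 0) (𝓝 0) := by
    have : Continuous fun t : ℝ => 4 * M * r ^ 2 * t := by fun_prop
    simpa using this.continuousAt.tendsto.mono_left (nhdsWithin_le_nhds (a := (0 : ℝ)))
  refine absurd (ge_of_tendsto hlim (b := |I|) ?_) (not_le.2 hpos)
  filter_upwards [self_mem_nhdsWithin] with t ht
  have h1 := hbound ⟨t, le_of_lt ht⟩
  change t * |I| ≤ 4 * M * (r * t) ^ 2 at h1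
  refine le_of_mul_le_mul_left (h1.trans_eq ?_) (show (0 : ℝ) < t from ht)
  ring

end Stationary

/-! ### The Lyapunov function -/

section Lyapunov

variable {N : ℕ} {g : ℕ → ℝ} {c : Fin N → ℝ} {lam : Fin N → ℝ≥0} {ψ : (Fin N → ℕ) → Fin N → ℝ}

/-- The Lyapunov function `∑ i, c i * (g 1 + ⋯ + g (x i))`. -/
def lyapunov (g : ℕ → ℝ) (c : Fin N → ℝ) (x : Fin N → ℕ) : ℝ :=
  ∑ i, c i * ∑ k ∈ Finset.range (x i), g (k + 1)

/-- The hypothesis on `g 0` is only needed, and only available, when there is at least one queue. -/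
lemma sum_le_lyapunov (hg : ∀ y, 0 ≤ g y) (h0 : ∀ _ : Fin N, g 0 = 0) (hc : ∀ i, 0 ≤ c i)
    (x : Fin N → ℕ) : ∑ i, c i * g (x i) ≤ lyapunov g c x := by
  refine Finset.sum_le_sum fun i _ => mul_le_mul_of_nonneg_left ?_ (hc i)
  rcases x i with _ | y
  · simp [h0 i]
  · exact Finset.single_le_sum (f := fun k => g (k + 1)) (fun _ _ => hg _)
      (Finset.self_mem_range_succ y)

/-- The case distinction reflects truncated subtraction: a departure from an empty queue leaves the
state unchanged. -/
lemma lyapunov_jump_sub (x : Fin N → ℕ) (k : Fin N ⊕ Fin N) :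
    lyapunov g c (jump x k) - lyapunov g c x =
      Sum.elim (fun i => c i * g (x i + 1)) (fun i => if x i = 0 then 0 else -(c i * g (x i))) k := by
  rw [lyapunov, lyapunov, ← Finset.sum_sub_distrib]
  rcases k with i | i
  · rw [Finset.sum_eq_single i (fun j _ hj => by simp [jump, hj]) (by simp)]
    simp [jump, Finset.sum_range_succ]
    ring
  · rw [Finset.sum_eq_single i (fun j _ hj => by simp [jump, hj]) (by simp)]
    simp only [jump, Sum.elim_inr, Pi.sub_apply, Pi.single_eq_same]
    rcases x i with _ | y
    · simp
    · simp [Finset.sum_range_succ]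
      ring

lemma generator_lyapunov (hψ0 : ∀ x i, x i = 0 → ψ x i = 0) (x : Fin N → ℕ) :
    generator lam ψ (lyapunov g c) x =
      ∑ i, c i * (lam i * g (x i + 1) - ψ x i * g (x i)) := by
  simp only [generator, lyapunov_jump_sub]
  rw [Fintype.sum_sum_type, ← Finset.sum_add_distrib]
  refine Finset.sum_congr rfl fun i _ => ?_
  simp only [eventRate, Sum.elim_inl, Sum.elim_inr]
  split_ifs with hx
  · rw [hψ0 x i hx]; ring
  · ring

/-- Truncating a function at level `m` is a concave operation, so it can only lower the
generator below the level, and leaves only downward jumps above it. -/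
lemma generator_min_le (hψ : ∀ x i, ψ x i ∈ Set.Icc (0 : ℝ) 1) (V : (Fin N → ℕ) → ℝ) (m : ℝ)
    (x : Fin N → ℕ) :
    generator lam ψ (fun y => min (V y) m) x ≤
      {y | V y < m}.indicator (generator lam ψ V) x := by
  have hrate : ∀ k, 0 ≤ eventRate lam ψ x k := by
    rintro (i | i)
    · exact NNReal.coe_nonneg _
    · exact (hψ x i).1
  by_cases hx : V x < m
  · rw [Set.indicator_of_mem (by exact hx)]
    refine Finset.sum_le_sum fun k _ => mul_le_mul_of_nonneg_left ?_ (hrate k)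
    beta_reduce
    rw [min_eq_left hx.le]
    linarith [min_le_left (V (jump x k)) m]
  · rw [Set.indicator_of_notMem (by exact hx)]
    refine Finset.sum_nonpos fun k _ => mul_nonpos_of_nonneg_of_nonpos (hrate k) ?_
    beta_reduce
    rw [min_eq_right (not_lt.1 hx)]
    linarith [min_le_right (V (jump x k)) m]

/-- The drift of the Lyapunov function is `-ε ∑ c i g(x i)` up to the increments of `g`. -/
lemma generator_lyapunov_le {h : ℝ → EReal} {C : Set (Fin N → ℝ)} (hg : ConditionG g)
    (hh : ConditionH h) (hψ : IsUtilityMaximising g h C ψ) {ν : Fin N → ℝ} (hν : ν ∈ C)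
    (hpos : ∀ i, 0 < ν i) {ε : ℝ} (hε : 0 < ε) (hlam : ∀ i, (lam i : ℝ) < ν i - ε)
    (x : Fin N → ℕ) :
    generator lam ψ (lyapunov g fun i => utilityDeriv h (ν i)) x ≤
      ∑ i, utilityDeriv h (ν i) * increment g (x i) -
        ε * ∑ i, utilityDeriv h (ν i) * g (x i) := by
  have h1 := hψ.weighted_sub_nonneg hg hh hν hpos x
  rw [generator_lyapunov hψ.eq_zero, ← sub_nonneg]
  refine h1.trans ?_
  rw [Finset.mul_sum, ← Finset.sum_sub_distrib, ← Finset.sum_sub_distrib]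
  refine Finset.sum_le_sum fun i _ => ?_
  have hc := hh.utilityDeriv_pos (hpos i)
  have h2 : (lam i : ℝ) ≤ 1 := by linarith [hlam i, hψ.rate_le_one hg hh hν hpos i]
  have h3 := mul_nonneg (sub_nonneg.2 h2) (hg.increment_pos (x i)).le
  have h4 := mul_nonneg (sub_nonneg.2 (hlam i).le) (hg.nonneg (x i))
  have h5 : g (x i + 1) = g (x i) + increment g (x i) := by rw [increment]; ring
  rw [h5]
  nlinarith [mul_nonneg hc.le (add_nonneg h3 h4)]

end Lyapunov

/-! ### Foster–Lyapunov bounds in the stationary regime -/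

section Foster

variable {N : ℕ} {Ω : Type*} [MeasurableSpace Ω] {P : Measure Ω}
  {lam : Fin N → ℝ≥0} {ψ : (Fin N → ℕ) → Fin N → ℝ} {A S : Fin N → ℝ≥0 → Ω → ℕ}
  {X : ℝ≥0 → Ω → Fin N → ℕ}

lemma measurableSet_sublevel {X₀ : Ω → Fin N → ℕ} (hX₀ : Measurable X₀) (V : (Fin N → ℕ) → ℝ)
    (m : ℝ) : MeasurableSet {ω | V (X₀ ω) < m} :=
  hX₀ (Set.to_countable {x | V x < m}).measurableSet

lemma aecover_sublevel {X₀ : Ω → Fin N → ℕ} (hX₀ : Measurable X₀) (V : (Fin N → ℕ) → ℝ) :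
    AECover P atTop fun m : ℕ => {ω | V (X₀ ω) < m} where
  ae_eventually_mem := Eventually.of_forall fun ω => by
    obtain ⟨m, hm⟩ := exists_nat_gt (V (X₀ ω))
    exact eventually_atTop.2 ⟨m, fun n hn => hm.trans_le (Nat.cast_le.2 hn)⟩
  measurableSet m := measurableSet_sublevel hX₀ V m

/-- If `b` dominates the drift of a nonnegative function `V`, then its mean over each sublevel set of
`V` is nonnegative, because the truncation of `V` at that level has drift of mean zero. -/
lemma IsQueueProcess.setIntegral_drift_nonneg [IsProbabilityMeasure P]
    (hX : IsQueueProcess P lam ψ A S X)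
    (hstat : IsStationary P X) (hψ : ∀ x i, ψ x i ∈ Set.Icc (0 : ℝ) 1) {V b : (Fin N → ℕ) → ℝ}
    (hV : ∀ x, 0 ≤ V x) (hb : ∀ x, generator lam ψ V x ≤ b x) (m : ℕ)
    (hint : IntegrableOn (fun ω => b (X 0 ω)) {ω | V (X 0 ω) < m} P) :
    0 ≤ ∫ ω in {ω | V (X 0 ω) < m}, b (X 0 ω) ∂P := by
  obtain ⟨h1, h2⟩ := hX.integral_generator_eq_zero hstat hψ (f := fun y => min (V y) m) (M := m)
    fun x => by
      rw [abs_of_nonneg (le_min (hV x) m.cast_nonneg)]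
      exact min_le_right _ _
  have hmeas := measurableSet_sublevel (hX.measurable 0) V m
  rw [← h2, ← integral_indicator hmeas]
  refine integral_mono h1 ((integrable_indicator_iff hmeas).2 hint) fun ω => ?_
  refine (generator_min_le hψ V m (X 0 ω)).trans ?_
  by_cases hω : V (X 0 ω) < m
  · rw [Set.indicator_of_mem (by exact hω), Set.indicator_of_mem (by exact hω)]
    exact hb _
  · rw [Set.indicator_of_notMem (by exact hω), Set.indicator_of_notMem (by exact hω)]

/-- A Foster–Lyapunov criterion: a drift bounded by `z - ε * w` with `w ≤ V` and `z ≤ δ * w + K`,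
`δ < ε`, forces `w` and `z` to be integrable and `ε * E w ≤ E z`. -/
theorem IsQueueProcess.foster [IsProbabilityMeasure P]
    (hX : IsQueueProcess P lam ψ A S X)
    (hstat : IsStationary P X) (hψ : ∀ x i, ψ x i ∈ Set.Icc (0 : ℝ) 1)
    {V w z : (Fin N → ℕ) → ℝ} {ε δ K : ℝ} (hδε : δ < ε) (hw0 : ∀ x, 0 ≤ w x)
    (hz0 : ∀ x, 0 ≤ z x) (hwV : ∀ x, w x ≤ V x) (hzw : ∀ x, z x ≤ δ * w x + K)
    (hdrift : ∀ x, generator lam ψ V x ≤ z x - ε * w x) :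
    Integrable (fun ω => w (X 0 ω)) P ∧ Integrable (fun ω => z (X 0 ω)) P ∧
      ε * ∫ ω, w (X 0 ω) ∂P ≤ ∫ ω, z (X 0 ω) ∂P := by
  have hcover := aecover_sublevel (P := P) (hX.measurable 0) V
  have hmeas : ∀ c : (Fin N → ℕ) → ℝ, AEStronglyMeasurable (fun ω => c (X 0 ω)) P := fun c =>
    ((measurable_of_countable c).comp (hX.measurable 0)).aestronglyMeasurable
  have hwint : ∀ m : ℕ, IntegrableOn (fun ω => w (X 0 ω)) {ω | V (X 0 ω) < m} P := fun m => by
    refine Integrable.of_bound (hmeas w).restrict m ?_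
    filter_upwards [ae_restrict_mem (measurableSet_sublevel (hX.measurable 0) V m)] with ω hω
    rw [Real.norm_eq_abs, abs_of_nonneg (hw0 _)]
    exact (hwV _).trans (le_of_lt hω)
  have hV : ∀ x, 0 ≤ V x := fun x => (hw0 x).trans (hwV x)
  have hw : Integrable (fun ω => w (X 0 ω)) P := by
    refine hcover.integrable_of_integral_bounded_of_nonneg_ae (|K| / (ε - δ)) hwint
      (Eventually.of_forall fun ω => hw0 _) (Eventually.of_forall fun m => ?_)
    -- the drift is at most `|K| - (ε - δ) * w`; `K` may be negative, and `P {V < m} ≤ 1`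
    have hint : IntegrableOn (fun ω => |K| - (ε - δ) * w (X 0 ω)) {ω | V (X 0 ω) < m} P :=
      (integrable_const _).sub ((hwint m).const_mul _)
    have h1 := hX.setIntegral_drift_nonneg hstat hψ (b := fun x => |K| - (ε - δ) * w x) hV
      (fun x => by linarith [hdrift x, hzw x, le_abs_self K]) m hint
    rw [integral_sub (integrable_const _) ((hwint m).const_mul _), integral_const_mul,
      setIntegral_const, smul_eq_mul] at h1
    rw [le_div_iff₀ (sub_pos.2 hδε)]
    have h2 : P.real {ω | V (X 0 ω) < m} * |K| ≤ 1 * |K| :=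
      mul_le_mul_of_nonneg_right measureReal_le_one (abs_nonneg K)
    linarith
  have hz : Integrable (fun ω => z (X 0 ω)) P := by
    refine ((hw.const_mul δ).add (integrable_const K)).mono' (hmeas z)
      (Eventually.of_forall fun ω => ?_)
    rw [Real.norm_eq_abs, abs_of_nonneg (hz0 _)]
    exact hzw _
  refine ⟨hw, hz, ?_⟩
  have hb : Integrable (fun ω => z (X 0 ω) - ε * w (X 0 ω)) P := hz.sub (hw.const_mul ε)
  have h0 := ge_of_tendsto' (hcover.integral_tendsto_of_countably_generated hb) fun m =>
    hX.setIntegral_drift_nonneg hstat hψ (b := fun x => z x - ε * w x) hV hdrift m hb.integrableOn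
  rw [integral_sub hz (hw.const_mul ε), integral_const_mul] at h0
  linarith

end Foster

end QueueNetwork

theorem mainTheorem4 {N : ℕ}
    (g : ℕ → ℝ) (h : ℝ → EReal)
    (hg : QueueNetwork.ConditionG g) (hh : QueueNetwork.ConditionH h)
    (C : Set (Fin N → ℝ)) (hC : QueueNetwork.IsRateSet C)
    (ψ : (Fin N → ℕ) → Fin N → ℝ) (hψ : QueueNetwork.IsUtilityMaximising g h C ψ)
    (lam : Fin N → ℝ≥0) (ν : Fin N → ℝ) (hν : ν ∈ C)
    (ε : ℝ) (hε : 0 < ε) (hlam : ∀ i, (lam i : ℝ) < ν i - ε)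
    {Ω : Type*} [MeasurableSpace Ω] (P : Measure Ω) [IsProbabilityMeasure P]
    (A S : Fin N → ℝ≥0 → Ω → ℕ) (X : ℝ≥0 → Ω → Fin N → ℕ)
    (hX : QueueNetwork.IsQueueProcess P lam ψ A S X)
    (hstat : QueueNetwork.IsStationary P X) :
    (∀ i, Integrable (fun ω => g (X 0 ω i)) P) ∧
    (∀ i, Integrable (fun ω => QueueNetwork.increment g (X 0 ω i)) P) ∧
    ∑ i, QueueNetwork.utilityDeriv h (ν i) * ∫ ω, g (X 0 ω i) ∂P ≤
      (1 / ε) * ∑ i, QueueNetwork.utilityDeriv h (ν i) *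
        ∫ ω, QueueNetwork.increment g (X 0 ω i) ∂P := by
  -- positivity of `ν i` makes `h'(ν i)` a genuine derivative
  have hpos : ∀ i, 0 < ν i := fun i => by linarith [hlam i, (lam i).coe_nonneg]
  set c : Fin N → ℝ := fun i => QueueNetwork.utilityDeriv h (ν i)
  have hcpos : ∀ i, 0 < c i := fun i => hh.utilityDeriv_pos (hpos i)
  -- half of the drift is spent on the increments, which leaves a negative drift to bound `E g`
  obtain ⟨K, hK⟩ := hg.exists_increment_le (half_pos hε)
  obtain ⟨hw, hz, hle⟩ := hX.foster hstat hψ.mem_Icc (V := QueueNetwork.lyapunov g c)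
    (w := fun x => ∑ i, c i * g (x i)) (z := fun x => ∑ i, c i * QueueNetwork.increment g (x i))
    (ε := ε) (δ := ε / 2) (K := ∑ i, c i * K) (half_lt_self hε)
    (fun x => Finset.sum_nonneg fun i _ => mul_nonneg (hcpos i).le (hg.nonneg _))
    (fun x => Finset.sum_nonneg fun i _ => mul_nonneg (hcpos i).le (hg.increment_pos _).le)
    (QueueNetwork.sum_le_lyapunov hg.nonneg (fun i => hψ.weight_zero hg hh hν hpos i)
      fun i => (hcpos i).le)
    (fun x => by
      rw [Finset.mul_sum, ← Finset.sum_add_distrib]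
      refine Finset.sum_le_sum fun i _ => ?_
      have := mul_le_mul_of_nonneg_left (hK (x i)) (hcpos i).le
      linarith)
    (QueueNetwork.generator_lyapunov_le hg hh hψ hν hpos hε hlam)
  have hterm : ∀ f : ℕ → ℝ, (∀ y, 0 ≤ f y) → Integrable (fun ω => ∑ i, c i * f (X 0 ω i)) P →
      ∀ i, Integrable (fun ω => f (X 0 ω i)) P := by
    intro f hf hint i
    refine (hint.const_mul (c i)⁻¹).mono' ((measurable_of_countable fun x : Fin N → ℕ =>
      f (x i)).comp (hX.measurable 0)).aestronglyMeasurable (Eventually.of_forall fun ω => ?_)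
    rw [Real.norm_eq_abs, abs_of_nonneg (hf _), le_inv_mul_iff₀ (hcpos i)]
    exact Finset.single_le_sum (f := fun i => c i * f (X 0 ω i))
      (fun j _ => mul_nonneg (hcpos j).le (hf _)) (Finset.mem_univ i)
  have hgi := hterm g hg.nonneg hw
  have hdi := hterm (QueueNetwork.increment g) (fun y => (hg.increment_pos y).le) hz
  refine ⟨hgi, hdi, ?_⟩
  rw [integral_finsetSum _ fun i _ => (hgi i).const_mul _,
    integral_finsetSum _ fun i _ => (hdi i).const_mul _] at hle
  simp only [integral_const_mul] at hle
  rwa [one_div, le_inv_mul_iff₀ hε]
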